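/- A loop is a set $Q$ with a binary operation and a two-sided neutral element $1$ such that all left translations $L_x : y \mapsto xy$ and all right translations $R_x : y \mapsto yx$ are bijections of $Q$. It is a Moufang loop if $x(y(xz)) = ((xy)x)z$ for all $x,y,z \in Q$. It is uniquely $6$-divisible if for every $x \in Q$ there is exactly one $y \in Q$ with $y^6 = x$. The inner mapping group $\mathrm{Inn}(Q)$ is the group of permutations of $Q$ generated by all the maps $z \mapsto x\backslash(zx)$, $z \mapsto (yx)\backslash(y(xz))$ and $z \mapsto ((zx)y)/(xy)$ with $x,y \in Q$, where $a\backslash b$ and $b/a$ denote the unique solutions $u$ of $au=b$ and $ua=b$. The center $Z(Q)$ is the set of elements fixed by every map in $\mathrm{Inn}(Q)$. The iterated centers are $Z_0(Q) = \{1\}$ and $Z_{i+1}(Q)$, the preimage in $Q$ of $Z(Q/Z_i(Q))$. The loop $Q$ is nilpotent of class $m$ if $m$ is the least integer with $Z_m(Q) = Q$. **Theorem.** Let $Q$ be a (finite or infinite) uniquely $6$-divisible Moufang loop such that $\mathrm{Inn}(Q)$ is abelian. Then $Q$ is nilpotent of class at most $2$. Moreover, $Q$ is a group. -/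

import Mathlib

/-- A loop: a multiplication with a two-sided neutral element `1`, all of whose left and right
translations are bijections. -/
class IsLoop (Q : Type*) [MulOneClass Q] : Prop where
  bijective_mul_left : ∀ x : Q, Function.Bijective (fun y : Q => x * y)
  bijective_mul_right : ∀ x : Q, Function.Bijective (fun y : Q => y * x)

/-- The Moufang identity. A Moufang loop is a loop satisfying it. -/
class IsMoufang (Q : Type*) [Mul Q] : Prop where
  moufang : ∀ x y z : Q, x * (y * (x * z)) = ((x * y) * x) * z

namespace IsLoop

/-- The power `x ^ n`, with `x ^ 0 = 1` and `x ^ (n + 1) = x ^ n * x`. (In a power-associative loop,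
such as a Moufang loop, the bracketing is immaterial.) -/
def power {Q : Type*} [MulOneClass Q] (x : Q) : ℕ → Q
  | 0 => 1
  | n + 1 => power x n * x

/-- `Q` is uniquely `m`-divisible: every element has exactly one `m`-th root. -/
def UniquelyDivisible (m : ℕ) (Q : Type*) [MulOneClass Q] : Prop :=
  ∀ x : Q, ∃! y : Q, power y m = x

section Basic

variable {Q : Type*} [MulOneClass Q] [IsLoop Q]

theorem mul_left_cancel' {x y z : Q} (h : x * y = x * z) : y = z :=
  (bijective_mul_left x).1 h

theorem mul_right_cancel' {x y z : Q} (h : y * x = z * x) : y = z :=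
  (bijective_mul_right x).1 h

/-- The left translation `y ↦ x * y`, as a permutation. -/
noncomputable def leftTranslation (x : Q) : Equiv.Perm Q :=
  Equiv.ofBijective (fun y : Q => x * y) (bijective_mul_left x)

/-- The right translation `y ↦ y * x`, as a permutation. -/
noncomputable def rightTranslation (x : Q) : Equiv.Perm Q :=
  Equiv.ofBijective (fun y : Q => y * x) (bijective_mul_right x)

@[simp] theorem leftTranslation_apply (x y : Q) : leftTranslation x y = x * y := rfl

@[simp] theorem rightTranslation_apply (x y : Q) : rightTranslation x y = y * x := rfl

/-- The middle inner mapping (conjugation) `T(x) : z ↦ x \ (z * x)`. Permutations are composed from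
right to left here. -/
noncomputable def middleInner (x : Q) : Equiv.Perm Q :=
  (leftTranslation x)⁻¹ * rightTranslation x

/-- The left inner mapping `L(x, y) : z ↦ (y * x) \ (y * (x * z))`. -/
noncomputable def leftInner (x y : Q) : Equiv.Perm Q :=
  (leftTranslation (y * x))⁻¹ * leftTranslation y * leftTranslation x

/-- The right inner mapping `R(x, y) : z ↦ ((z * x) * y) / (x * y)`. -/
noncomputable def rightInner (x y : Q) : Equiv.Perm Q :=
  (rightTranslation (x * y))⁻¹ * rightTranslation y * rightTranslation x

theorem mul_middleInner (x z : Q) : x * middleInner x z = z * x := by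
  change leftTranslation x ((leftTranslation x)⁻¹ (z * x)) = z * x
  simp [-leftTranslation_apply]

theorem mul_leftInner (x y z : Q) : (y * x) * leftInner x y z = y * (x * z) := by
  change leftTranslation (y * x) ((leftTranslation (y * x))⁻¹ (y * (x * z))) = _
  simp [-leftTranslation_apply]

theorem rightInner_mul (x y z : Q) : rightInner x y z * (x * y) = (z * x) * y := by
  change rightTranslation (x * y) ((rightTranslation (x * y))⁻¹ ((z * x) * y)) = _
  simp [-rightTranslation_apply]

variable (Q) in
/-- The inner mapping group `Inn(Q)`: the permutation group generated by all middle, left and right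
inner mappings. -/
noncomputable def Inn : Subgroup (Equiv.Perm Q) :=
  Subgroup.closure
    (Set.range (fun x : Q => middleInner x) ∪
      Set.range (fun p : Q × Q => leftInner p.1 p.2) ∪
      Set.range (fun p : Q × Q => rightInner p.1 p.2))

theorem middleInner_mem (x : Q) : middleInner x ∈ Inn Q :=
  Subgroup.subset_closure (Or.inl (Or.inl ⟨x, rfl⟩))

theorem leftInner_mem (x y : Q) : leftInner x y ∈ Inn Q :=
  Subgroup.subset_closure (Or.inl (Or.inr ⟨(x, y), rfl⟩))

theorem rightInner_mem (x y : Q) : rightInner x y ∈ Inn Q :=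
  Subgroup.subset_closure (Or.inr ⟨(x, y), rfl⟩)

/-- The fixed points of `Inn(Q)` are the elements that commute and associate with all others. -/
theorem fixed_iff (z : Q) : (∀ φ ∈ Inn Q, φ z = z) ↔
    (∀ x, z * x = x * z) ∧ (∀ x y, y * (x * z) = (y * x) * z) ∧
      (∀ x y, (z * x) * y = z * (x * y)) := by
  constructor
  · intro h
    refine ⟨fun x => ?_, fun x y => ?_, fun x y => ?_⟩
    · have := mul_middleInner x z
      rw [h _ (middleInner_mem x)] at this
      exact this.symm
    · have := mul_leftInner x y z
      rw [h _ (leftInner_mem x y)] at this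
      exact this.symm
    · have := rightInner_mul x y z
      rw [h _ (rightInner_mem x y)] at this
      exact this.symm
  · rintro ⟨h1, h2, h3⟩ φ hφ
    have hle : Inn Q ≤ MulAction.stabilizer (Equiv.Perm Q) z := by
      refine (Subgroup.closure_le _).2 ?_
      rintro _ ((⟨x, rfl⟩ | ⟨⟨x, y⟩, rfl⟩) | ⟨⟨x, y⟩, rfl⟩)
      · exact mul_left_cancel' ((mul_middleInner x z).trans (h1 x))
      · exact mul_left_cancel' ((mul_leftInner x y z).trans (h2 x y))
      · exact mul_right_cancel' ((rightInner_mul x y z).trans (h3 x y))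
    exact hle hφ

variable (Q) in
/-- A normal subloop of `Q`: a subset containing `1`, closed under multiplication and under both
divisions, and invariant under the group `Inn(Q)`. -/
structure NormalSubloop where
  carrier : Set Q
  one_mem : 1 ∈ carrier
  mul_mem : ∀ {x y : Q}, x ∈ carrier → y ∈ carrier → x * y ∈ carrier
  left_div_mem : ∀ {x y : Q}, x ∈ carrier → x * y ∈ carrier → y ∈ carrier
  right_div_mem : ∀ {x y : Q}, y ∈ carrier → x * y ∈ carrier → x ∈ carrier
  inn_mem : ∀ φ ∈ Inn Q, ∀ {x : Q}, x ∈ carrier → φ x ∈ carrier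

variable (Q) in
/-- The center `Z(Q)`: the fixed points of `Inn(Q)`. -/
def center : NormalSubloop Q where
  carrier := {x | ∀ φ ∈ Inn Q, φ x = x}
  one_mem := (fixed_iff 1).2 ⟨by simp, by simp, by simp⟩
  mul_mem := by
    intro a b ha hb
    obtain ⟨a1, a2, a3⟩ := (fixed_iff a).1 ha
    obtain ⟨b1, b2, b3⟩ := (fixed_iff b).1 hb
    refine (fixed_iff (a * b)).2 ⟨fun x => ?_, fun x y => ?_, fun x y => ?_⟩
    · rw [a3, b1, ← a3, a1, ← b2]
    · rw [b2, b2, a2, ← b2]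
    · rw [a3, a3, b3, ← a3]
  left_div_mem := by
    intro x a hx hxa
    obtain ⟨x1, x2, x3⟩ := (fixed_iff x).1 hx
    obtain ⟨y1, y2, y3⟩ := (fixed_iff (x * a)).1 hxa
    refine (fixed_iff a).2 ⟨fun b => ?_, fun c b => ?_, fun b c => ?_⟩
    · apply mul_left_cancel' (x := x)
      rw [← x3, y1, x1 (b * a), ← x2, x1 a]
    · apply mul_left_cancel' (x := x)
      calc x * (b * (c * a)) = b * ((c * a) * x) := by rw [x1, ← x2]
        _ = b * (c * (x * a)) := by rw [← x2, x1 a]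
        _ = (b * c) * (x * a) := y2 c b
        _ = x * ((b * c) * a) := by rw [x1 a, x2, x1]
    · apply mul_left_cancel' (x := x)
      rw [← x3, ← x3, y3, x3]
  right_div_mem := by
    intro a x hx hax
    obtain ⟨x1, x2, x3⟩ := (fixed_iff x).1 hx
    obtain ⟨y1, y2, y3⟩ := (fixed_iff (a * x)).1 hax
    rw [← x1] at y1 y2 y3
    refine (fixed_iff a).2 ⟨fun b => ?_, fun c b => ?_, fun b c => ?_⟩
    · apply mul_left_cancel' (x := x)
      rw [← x3, y1, x1 (b * a), ← x2, x1 a]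
    · apply mul_left_cancel' (x := x)
      calc x * (b * (c * a)) = b * ((c * a) * x) := by rw [x1, ← x2]
        _ = b * (c * (x * a)) := by rw [← x2, x1 a]
        _ = (b * c) * (x * a) := y2 c b
        _ = x * ((b * c) * a) := by rw [x1 a, x2, x1]
    · apply mul_left_cancel' (x := x)
      rw [← x3, ← x3, y3, x3]
  inn_mem := by
    intro φ hφ x hx
    rw [hx φ hφ]
    exact hx

variable (Q) in
/-- The trivial normal subloop `{1}`. -/
def trivial : NormalSubloop Q where
  carrier := {1}
  one_mem := rfl
  mul_mem := by
    rintro x y rfl rfl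
    simp
  left_div_mem := by
    rintro x y rfl h
    simpa using h
  right_div_mem := by
    rintro x y rfl h
    simpa using h
  inn_mem := by
    rintro φ hφ x rfl
    exact (center Q).one_mem φ hφ

namespace NormalSubloop

variable (N : NormalSubloop Q)

theorem exists_mul_left {n : Q} (hn : n ∈ N.carrier) (x : Q) :
    ∃ m ∈ N.carrier, n * x = x * m :=
  ⟨_, N.inn_mem _ (middleInner_mem x) hn, (mul_middleInner x n).symm⟩

theorem exists_mul_right {n : Q} (hn : n ∈ N.carrier) (x : Q) :
    ∃ m ∈ N.carrier, x * n = m * x := by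
  refine ⟨(middleInner x)⁻¹ n, N.inn_mem _ (inv_mem (middleInner_mem x)) hn, ?_⟩
  rw [← mul_middleInner x]
  simp

theorem exists_assoc_left {n : Q} (hn : n ∈ N.carrier) (x y : Q) :
    ∃ m ∈ N.carrier, x * (y * n) = (x * y) * m :=
  ⟨_, N.inn_mem _ (leftInner_mem y x) hn, (mul_leftInner y x n).symm⟩

theorem exists_assoc_left' {n : Q} (hn : n ∈ N.carrier) (x y : Q) :
    ∃ m ∈ N.carrier, (x * y) * n = x * (y * m) := by
  refine ⟨(leftInner y x)⁻¹ n, N.inn_mem _ (inv_mem (leftInner_mem y x)) hn, ?_⟩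
  rw [← mul_leftInner y x]
  simp

theorem exists_assoc_right {n : Q} (hn : n ∈ N.carrier) (x y : Q) :
    ∃ m ∈ N.carrier, (n * x) * y = m * (x * y) :=
  ⟨_, N.inn_mem _ (rightInner_mem x y) hn, (rightInner_mul x y n).symm⟩

theorem exists_assoc_right' {n : Q} (hn : n ∈ N.carrier) (x y : Q) :
    ∃ m ∈ N.carrier, n * (x * y) = (m * x) * y := by
  refine ⟨(rightInner x y)⁻¹ n, N.inn_mem _ (inv_mem (rightInner_mem x y)) hn, ?_⟩
  rw [← rightInner_mul x y]
  simp

/-- The congruence of a normal subloop `N`: `x` and `y` are related when `y` is in the coset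
`x N`. -/
def con : Con Q where
  r x y := ∃ n ∈ N.carrier, y = x * n
  iseqv :=
    { refl := fun x => ⟨1, N.one_mem, (mul_one x).symm⟩
      symm := by
        rintro x y ⟨n, hn, rfl⟩
        obtain ⟨m, hm⟩ := (bijective_mul_left n).2 1
        replace hm : n * m = 1 := hm
        have hmN : m ∈ N.carrier := N.left_div_mem hn (by rw [hm]; exact N.one_mem)
        obtain ⟨k, hk, e⟩ := N.exists_assoc_left hmN x n
        exact ⟨k, hk, by rw [← e, hm, mul_one]⟩
      trans := by
        rintro x y z ⟨n, hn, rfl⟩ ⟨m, hm, rfl⟩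
        obtain ⟨k, hk, e⟩ := N.exists_assoc_left' hm x n
        exact ⟨n * k, N.mul_mem hn hk, e⟩ }
  mul' := by
    rintro x x' y y' ⟨n, hn, rfl⟩ ⟨m, hm, rfl⟩
    obtain ⟨m1, hm1, e1⟩ := N.exists_assoc_left hm (x * n) y
    obtain ⟨n1, hn1, e2⟩ := N.exists_mul_right hn x
    obtain ⟨n2, hn2, e3⟩ := N.exists_assoc_right hn1 x y
    obtain ⟨n3, hn3, e4⟩ := N.exists_mul_left hn2 (x * y)
    obtain ⟨m2, hm2, e5⟩ := N.exists_assoc_left' hm1 (x * y) n3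
    exact ⟨n3 * m2, N.mul_mem hn3 hm2, by rw [e1, e2, e3, e4, e5]⟩

/-- The factor loop `Q / N`, with the induced multiplication. -/
abbrev Factor : Type _ := N.con.Quotient

/-- The canonical projection `Q → Q / N`. -/
def proj (x : Q) : N.Factor := (x : N.con.Quotient)

theorem proj_surjective : Function.Surjective N.proj := Quotient.mk_surjective

theorem proj_mul (x y : Q) : N.proj (x * y) = N.proj x * N.proj y := rfl

theorem proj_one : N.proj 1 = 1 := rfl

theorem proj_eq {x y : Q} : N.proj x = N.proj y ↔ ∃ n ∈ N.carrier, y = x * n := N.con.eq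

instance : IsLoop N.Factor where
  bijective_mul_left := by
    intro a
    obtain ⟨x, rfl⟩ := N.proj_surjective a
    constructor
    · intro b c h
      obtain ⟨y, rfl⟩ := N.proj_surjective b
      obtain ⟨z, rfl⟩ := N.proj_surjective c
      obtain ⟨n, hn, e⟩ := N.proj_eq.1 (show N.proj (x * y) = N.proj (x * z) from h)
      obtain ⟨m, hm, e'⟩ := N.exists_assoc_left' hn x y
      exact N.proj_eq.2 ⟨m, hm, mul_left_cancel' (e.trans e')⟩
    · intro b
      obtain ⟨y, rfl⟩ := N.proj_surjective b
      obtain ⟨z, rfl⟩ := (bijective_mul_left x).2 y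
      exact ⟨N.proj z, rfl⟩
  bijective_mul_right := by
    intro a
    obtain ⟨x, rfl⟩ := N.proj_surjective a
    constructor
    · intro b c h
      obtain ⟨y, rfl⟩ := N.proj_surjective b
      obtain ⟨z, rfl⟩ := N.proj_surjective c
      obtain ⟨n, hn, e⟩ := N.proj_eq.1 (show N.proj (y * x) = N.proj (z * x) from h)
      obtain ⟨n1, hn1, e1⟩ := N.exists_mul_right hn (y * x)
      obtain ⟨n2, hn2, e2⟩ := N.exists_assoc_right' hn1 y x
      obtain ⟨n3, hn3, e3⟩ := N.exists_mul_left hn2 y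
      refine N.proj_eq.2 ⟨n3, hn3, ?_⟩
      rw [← e3]
      exact mul_right_cancel' (e.trans (e1.trans e2))
    · intro b
      obtain ⟨y, rfl⟩ := N.proj_surjective b
      obtain ⟨z, rfl⟩ := (bijective_mul_right x).2 y
      exact ⟨N.proj z, rfl⟩

/-- Inner mappings of `Q` induce inner mappings of `Q / N`. -/
theorem exists_inn_factor (φ : Equiv.Perm Q) (hφ : φ ∈ Inn Q) :
    ∃ ψ ∈ Inn N.Factor, ∀ x, N.proj (φ x) = ψ (N.proj x) := by
  induction hφ using Subgroup.closure_induction with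
  | mem φ h =>
    rcases h with ((⟨x, rfl⟩ | ⟨⟨x, y⟩, rfl⟩) | ⟨⟨x, y⟩, rfl⟩)
    · refine ⟨_, middleInner_mem (N.proj x), fun z => mul_left_cancel' (x := N.proj x) ?_⟩
      rw [mul_middleInner, ← proj_mul, mul_middleInner, proj_mul]
    · refine ⟨_, leftInner_mem (N.proj x) (N.proj y), fun z =>
        mul_left_cancel' (x := N.proj y * N.proj x) ?_⟩
      rw [mul_leftInner, ← proj_mul, ← proj_mul, mul_leftInner, proj_mul, proj_mul]
    · refine ⟨_, rightInner_mem (N.proj x) (N.proj y), fun z =>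
        mul_right_cancel' (x := N.proj x * N.proj y) ?_⟩
      rw [rightInner_mul, ← proj_mul, ← proj_mul, rightInner_mul, proj_mul, proj_mul]
  | one => exact ⟨1, (Inn N.Factor).one_mem, fun x => rfl⟩
  | mul φ₁ φ₂ _ _ h₁ h₂ =>
    obtain ⟨ψ₁, m₁, e₁⟩ := h₁
    obtain ⟨ψ₂, m₂, e₂⟩ := h₂
    exact ⟨ψ₁ * ψ₂, (Inn N.Factor).mul_mem m₁ m₂, fun x => by simp [e₁, e₂]⟩
  | inv φ _ h =>
    obtain ⟨ψ, m, e⟩ := h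
    refine ⟨ψ⁻¹, inv_mem m, fun x => ψ.injective ?_⟩
    rw [← e]
    simp

/-- The preimage in `Q` of a normal subloop of `Q / N`. -/
def preimage (M : NormalSubloop N.Factor) : NormalSubloop Q where
  carrier := {x | N.proj x ∈ M.carrier}
  one_mem := M.one_mem
  mul_mem := fun hx hy => M.mul_mem hx hy
  left_div_mem := fun hx hxy => M.left_div_mem hx hxy
  right_div_mem := fun hy hxy => M.right_div_mem hy hxy
  inn_mem := by
    intro φ hφ x hx
    obtain ⟨ψ, hψ, e⟩ := N.exists_inn_factor φ hφ
    change N.proj (φ x) ∈ M.carrier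
    rw [e]
    exact M.inn_mem ψ hψ hx

end NormalSubloop

variable (Q) in
/-- The iterated centers: `Z₀(Q) = {1}`, and `Zᵢ₊₁(Q)` is the preimage in `Q` of the center of
`Q / Zᵢ(Q)`. -/
def iteratedCenter : ℕ → NormalSubloop Q
  | 0 => trivial Q
  | i + 1 => (iteratedCenter i).preimage (center (iteratedCenter i).Factor)

variable (Q) in
/-- `Q` is nilpotent of class `m`: `m` is the least number with `Z_m(Q) = Q`. -/
def HasNilpotencyClass (m : ℕ) : Prop :=
  IsLeast {i : ℕ | (iteratedCenter Q i).carrier = Set.univ} m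

end Basic

end IsLoop

/-! Write T_x for `middleInner x` and [x, z] for `loopCommutator x z`. Everything rests on
`leftInner x y` fixing x. If inner mappings commute, it also fixes φ x for every inner φ, so x and φ
x associate with everything (`assocPair_inn`). Hence [x, z] commutes with x and z and forms an
associating pair with each. Now T_x is a pseudoautomorphism with companion x³. Comparing the
companions of the equal maps T_x T_y and T_y T_x puts cubes of commutators in the nucleus, and
divisibility removes the cube (`isNuclear_loopCommutator`).

Nuclear commutators make left inner mappings automorphisms, and their commuting with the T_z makes
associators central (`exists_central_leftInner`). The double commutator [[x, z], w] is inverted by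
swapping x and z and unchanged by swapping z and w. It therefore equals its inverse and is trivial,
so commutators are central (`isCentral_loopCommutator`).

Finally `defect c` is bimultiplicative, symmetric and trivial on the diagonal, so its values square
to 1 and are 1 (`defect_eq_one`). This is associativity, and central commutators then give class at
most 2. -/

set_option linter.unusedSectionVars false

namespace IsLoop

/-! ### Inverses and the Moufang identities -/

section Moufang

variable {Q : Type*} [MulOneClass Q] [IsLoop Q]

/-- The inverse of an element of a loop: the solution `y` of `x * y = 1`. -/
@[reducible] noncomputable def loopInv : Inv Q :=
  ⟨fun x => Classical.choose ((bijective_mul_left x).2 1)⟩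

attribute [local instance] loopInv

theorem mul_inv_self' (x : Q) : x * x⁻¹ = 1 :=
  Classical.choose_spec ((bijective_mul_left x).2 1)

variable [IsMoufang Q]

theorem flexible (x y : Q) : (x * y) * x = x * (y * x) := by
  have := IsMoufang.moufang x y 1
  simpa using this.symm

theorem inv_mul_cancel_left' (x y : Q) : x⁻¹ * (x * y) = y := by
  apply mul_left_cancel' (x := x)
  rw [IsMoufang.moufang, mul_inv_self', one_mul]

theorem inv_mul_self' (x : Q) : x⁻¹ * x = 1 := by
  simpa using inv_mul_cancel_left' x 1

theorem inv_inv' (x : Q) : x⁻¹⁻¹ = x :=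
  mul_left_cancel' (x := x⁻¹) (by rw [mul_inv_self', inv_mul_self'])

theorem mul_inv_cancel_left' (x y : Q) : x * (x⁻¹ * y) = y := by
  simpa only [inv_inv'] using inv_mul_cancel_left' x⁻¹ y

theorem mul_inv_cancel_right' (y x : Q) : (y * x) * x⁻¹ = y := by
  have := IsMoufang.moufang x (x⁻¹ * y) x⁻¹
  rw [mul_inv_self', mul_one, mul_inv_cancel_left'] at this
  exact this.symm

theorem inv_mul_cancel_right' (y x : Q) : (y * x⁻¹) * x = y := by
  simpa only [inv_inv'] using mul_inv_cancel_right' y x⁻¹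

theorem eq_inv_of_mul_eq_one {x y : Q} (h : x * y = 1) : y = x⁻¹ :=
  mul_left_cancel' (x := x) (h.trans (mul_inv_self' x).symm)

theorem mul_inv_rev' (x y : Q) : (x * y)⁻¹ = y⁻¹ * x⁻¹ := by
  have h := inv_mul_cancel_left' (x * y) y⁻¹
  rw [mul_inv_cancel_right'] at h
  have h2 := mul_inv_cancel_right' (x * y)⁻¹ x
  rw [h] at h2
  exact h2.symm

theorem inv_injective' {x y : Q} (h : x⁻¹ = y⁻¹) : x = y := by
  rw [← inv_inv' x, h, inv_inv']

theorem left_alternative (x y : Q) : (x * x) * y = x * (x * y) := by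
  have := IsMoufang.moufang x 1 y
  simpa using this.symm

/-- Inversion is an antiautomorphism, so it mirrors the left identity. -/
theorem right_moufang (x y z : Q) : ((z * x) * y) * x = z * (x * (y * x)) := by
  apply inv_injective'
  have := IsMoufang.moufang x⁻¹ y⁻¹ z⁻¹
  simp only [mul_inv_rev', this]

theorem right_alternative (y x : Q) : y * (x * x) = (y * x) * x := by
  have := right_moufang x 1 y
  simpa using this.symm

/-- The autotopism with third component the left translation by `x`. -/
theorem mul_mul_autotopism (x y z : Q) : ((x * y) * x) * (x⁻¹ * z) = x * (y * z) := by
  rw [← IsMoufang.moufang, mul_inv_cancel_left']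

theorem inv_mul_autotopism (x y z : Q) :
    ((x⁻¹ * y) * x⁻¹) * (x * z) = x⁻¹ * (y * z) := by
  simpa only [inv_inv'] using mul_mul_autotopism x⁻¹ y z

/-- The autotopism with third component the right translation by `x`. -/
theorem mul_right_autotopism (x y z : Q) : (y * x⁻¹) * ((x * z) * x) = (y * z) * x := by
  rw [flexible, ← right_moufang, inv_mul_cancel_right']

theorem middle_moufang (x y z : Q) : (x * y) * (z * x) = x * ((y * z) * x) := by
  have h := mul_mul_autotopism x (y * z) z⁻¹
  rw [mul_inv_cancel_right'] at h
  rw [← h, ← mul_inv_rev', ← flexible, inv_mul_cancel_right']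

/-! ### Pairs of elements associating with everything -/

/-- `x`, `u` associate with every element: the left translation by `x` commutes with the right
translation by `u`. -/
def AssocPair (x u : Q) : Prop := ∀ z, (x * z) * u = x * (z * u)

namespace AssocPair

variable {x u v : Q}

theorem inv_left (h : AssocPair x u) : AssocPair x⁻¹ u := fun z => by
  apply mul_left_cancel' (x := x)
  rw [mul_inv_cancel_left', ← h, mul_inv_cancel_left']

theorem inv_right (h : AssocPair x u) : AssocPair x u⁻¹ := fun z => by
  apply mul_right_cancel' (x := u)
  rw [inv_mul_cancel_right', h, inv_mul_cancel_right']

theorem symm (h : AssocPair x u) : AssocPair u x := fun z => by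
  apply inv_injective'
  simp only [mul_inv_rev']
  exact (h.inv_left.inv_right z⁻¹).symm

/-- With the next lemma and `of_mul_mul_right`: the Moufang identities transfer associativity
between the possible positions of the arbitrary factor. -/
theorem mul_mul_right (h : AssocPair x u) (y : Q) : (y * x) * u = y * (x * u) := by
  apply mul_left_cancel' (x := x)
  rw [← h, ← flexible, ← IsMoufang.moufang]

theorem mul_mul_left (h : AssocPair x u) (y : Q) : (x * u) * y = x * (u * y) := by
  apply mul_right_cancel' (x := u)
  rw [right_moufang, ← flexible, h]

theorem of_mul_mul_right (h : ∀ y, (y * x) * u = y * (x * u)) : AssocPair x u := fun z => by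
  obtain ⟨y, rfl⟩ := (bijective_mul_right x).2 z
  change (x * (y * x)) * u = x * ((y * x) * u)
  rw [h, IsMoufang.moufang, flexible]

theorem self (x : Q) : AssocPair x x := fun z => flexible x z

theorem mul_right (hu : AssocPair x u) (hv : AssocPair x v) (huv : AssocPair u v) :
    AssocPair x (u * v) := fun z => by
  rw [← huv.mul_mul_right, hu, hv, huv.mul_mul_right]

theorem inv_mul (h : AssocPair x u) : AssocPair x (x⁻¹ * u) :=
  mul_right (self x).inv_right h h.inv_left

end AssocPair

/-! ### Cubes -/

/-- The cube of an element. -/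
def cube (x : Q) : Q := (x * x) * x

theorem cube_mul (x y : Q) : cube x * y = x * (x * (x * y)) :=
  (IsMoufang.moufang x x y).symm

theorem mul_cube (x y : Q) : y * cube x = ((y * x) * x) * x := by
  rw [cube, flexible, right_moufang]

theorem inv_cube (x : Q) : (cube x)⁻¹ = cube x⁻¹ := by
  simp only [cube, mul_inv_rev', flexible]

theorem AssocPair.cube_right {x u : Q} (h : AssocPair x u) : AssocPair x (cube u) := fun z => by
  simp only [mul_cube, h _]

theorem AssocPair.cube {x u : Q} (h : AssocPair x u) : AssocPair (cube x) (cube u) :=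
  h.cube_right.symm.cube_right.symm

theorem cube_mul_of_commute {x u : Q} (h : AssocPair x u) (hc : x * u = u * x) :
    cube (x * u) = cube x * cube u := by
  have key : ∀ z, u * (x * z) = x * (u * z) := fun z => by
    rw [← h.symm.mul_mul_left, ← hc, h.mul_mul_left]
  have h1 := cube_mul (x * u) 1
  have h2 := cube_mul x (cube u)
  have h3 := cube_mul u 1
  simp only [mul_one] at h1 h3
  rw [h1, h2, h3]
  simp only [h.mul_mul_left, key]

/-- The factorizations 6 = 3·2 = 2·3 turn unique 6-divisibility into bijectivity of cubing and
absence of elements of order 2. -/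
theorem power_six_eq_square (x : Q) : power x 6 = cube x * cube x := by
  rw [mul_cube]
  simp [power, cube]

theorem power_six_eq_cube (x : Q) : power x 6 = cube (x * x) := by
  simp [power, cube, right_alternative]

section Divisible

variable (hdiv : UniquelyDivisible 6 Q)
include hdiv

theorem cube_injective : Function.Injective (cube (Q := Q)) := fun x y h =>
  (hdiv (power x 6)).unique rfl (by rw [power_six_eq_square, power_six_eq_square, h])

theorem eq_one_of_mul_self {x : Q} (h : x * x = 1) : x = 1 :=
  (hdiv (power x 6)).unique rfl (by rw [power_six_eq_cube, power_six_eq_cube, h, one_mul])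

theorem cube_surjective : Function.Surjective (cube (Q := Q)) := fun x => by
  obtain ⟨y, hy, -⟩ := hdiv x
  exact ⟨y * y, by rw [← power_six_eq_cube]; exact hy⟩

end Divisible

/-! ### Pseudoautomorphisms -/

/-- `f` is a pseudoautomorphism with companion `c`. -/
def PseudoAut (f : Q → Q) (c : Q) : Prop := ∀ y z, (f y * c⁻¹) * (c * f z) = f (y * z)

/-- Setting z = 1, then y = 1, expresses `a` and `b` through `f` and `b 1`. -/
theorem PseudoAut.of_autotopism {a b f : Q → Q} (h : ∀ y z, a y * b z = f (y * z))
    (h1 : f 1 = 1) : PseudoAut f (b 1) := fun y z => by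
  have ha : ∀ y, a y = f y * (b 1)⁻¹ := fun y => by
    have := h y 1
    rw [mul_one] at this
    rw [← this, mul_inv_cancel_right']
  have hb : b 1 * f z = b z := by
    have := h 1 z
    rw [ha, h1, one_mul, one_mul] at this
    rw [← this, mul_inv_cancel_left']
  rw [← ha, hb, h]

namespace PseudoAut

variable {f g : Q → Q} {c d : Q}

theorem map_one (h : PseudoAut f c) : f 1 = 1 := by
  have := h 1 1
  rw [middle_moufang, inv_mul_self', one_mul, mul_one] at this
  apply mul_left_cancel' (x := f 1)
  rw [this, mul_one]

theorem comp (hf : PseudoAut f c) (hg : PseudoAut g d) :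
    PseudoAut (fun x => f (g x)) (c * f d) := by
  have := of_autotopism (a := fun y => f (g y * d⁻¹) * c⁻¹) (b := fun z => c * f (d * g z))
    (f := fun x => f (g x)) (fun y z => by rw [hf, hg]) (by simp [hf.map_one, hg.map_one])
  simpa [hg.map_one] using this

/-- Middle Moufang cancels the companion when both arguments agree, so squares survive although
products need not. -/
theorem map_mul_self (h : PseudoAut f c) (y : Q) : f (y * y) = f y * f y := by
  rw [← h, middle_moufang, inv_mul_self', one_mul]

theorem map_cube (h : PseudoAut f c) (y : Q) : f (cube y) = cube (f y) := by
  rw [cube, ← h, h.map_mul_self, left_alternative, middle_moufang, inv_mul_cancel_right', cube,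
    flexible]

end PseudoAut

/-! ### The nucleus -/

/-- `n` is in the nucleus: it associates with everything. -/
def IsNuclear (n : Q) : Prop := ∀ x, AssocPair x n

theorem PseudoAut.exists_nuclear {f : Q → Q} {c d : Q} (hf : Function.Surjective f)
    (hc : PseudoAut f c) (hd : PseudoAut f d) : ∃ n, IsNuclear n ∧ c = n * d := by
  -- Cancelling `f` leaves an autotopism with identity third component; evaluation at 1 shows that
  -- its other components are translations.
  have key : ∀ y z : Q, ((y * d) * c⁻¹) * (c * (d⁻¹ * z)) = y * z := fun y z => by
    obtain ⟨y', hy⟩ := hf (y * d)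
    obtain ⟨z', hz⟩ := hf (d⁻¹ * z)
    rw [← hy, ← hz, hc, ← hd, hy, hz, mul_inv_cancel_right', mul_inv_cancel_left']
  have hl : ∀ z, c * (d⁻¹ * z) = (c * d⁻¹) * z := fun z => by
    have := key 1 z
    rw [one_mul, one_mul] at this
    apply mul_left_cancel' (x := d * c⁻¹)
    rw [this, ← inv_inv' d, ← mul_inv_rev', inv_inv' d, inv_mul_cancel_left']
  have hr : ∀ y, (y * d) * c⁻¹ = y * (c * d⁻¹)⁻¹ := fun y => by
    have := key y 1
    rw [mul_one, mul_one] at this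
    rw [← mul_inv_cancel_right' (y * d * c⁻¹) (c * d⁻¹), this]
  refine ⟨c * d⁻¹, fun z => AssocPair.symm (AssocPair.of_mul_mul_right fun y => ?_),
    (inv_mul_cancel_right' c d).symm⟩
  have := key (y * (c * d⁻¹)) z
  rw [hl, hr, mul_inv_cancel_right'] at this
  exact this.symm

theorem IsNuclear.inv {n : Q} (hn : IsNuclear n) : IsNuclear n⁻¹ := fun x => (hn x).inv_right

theorem IsNuclear.mul {n m : Q} (hn : IsNuclear n) (hm : IsNuclear m) : IsNuclear (n * m) :=
  fun x => (hn x).mul_right (hm x) (hm n)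

theorem PseudoAut.map_mul {f : Q → Q} {c : Q} (h : PseudoAut f c) (hc : IsNuclear c) (y z : Q) :
    f (y * z) = f y * f z := by
  rw [← h, ← (hc (f z)).symm.mul_mul_right, inv_mul_cancel_right']

/-! ### Inner mappings of Moufang loops -/

theorem middleInner_eq (x z : Q) : middleInner x z = x⁻¹ * (z * x) := by
  rw [← mul_middleInner x z, inv_mul_cancel_left']

theorem leftInner_eq (x y z : Q) : leftInner x y z = (y * x)⁻¹ * (y * (x * z)) := by
  rw [← mul_leftInner x y z, inv_mul_cancel_left']

theorem pseudoAut_middleInner (x : Q) : PseudoAut (middleInner x) (cube x) := by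
  have := PseudoAut.of_autotopism (a := fun y => (x⁻¹ * (y * x⁻¹)) * x⁻¹)
    (b := fun z => x * ((x * z) * x)) (f := middleInner x)
    (fun y z => by rw [inv_mul_autotopism, mul_right_autotopism, middleInner_eq])
    (by rw [middleInner_eq, one_mul, inv_mul_self'])
  simpa [cube, flexible] using this

theorem pseudoAut_leftInner (x y : Q) :
    PseudoAut (leftInner x y) ((y * x) * (y⁻¹ * x⁻¹)) := by
  have := PseudoAut.of_autotopism
    (a := fun u => ((y * x)⁻¹ * ((y * ((x * u) * x)) * y)) * (y * x)⁻¹)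
    (b := fun v => (y * x) * (y⁻¹ * (x⁻¹ * v))) (f := leftInner x y)
    (fun u v => by
      rw [inv_mul_autotopism, mul_mul_autotopism, mul_mul_autotopism, leftInner_eq])
    (by rw [leftInner_eq, mul_one, inv_mul_self'])
  simpa using this

theorem isNuclear_iff_leftInner {n : Q} : IsNuclear n ↔ ∀ x y, leftInner x y n = n := by
  constructor
  · intro h x y
    rw [leftInner_eq, ← h, inv_mul_cancel_left']
  · intro h y x
    rw [← mul_leftInner, h]

theorem leftInner_self (x y : Q) : leftInner x y x = x := by
  rw [leftInner_eq, right_alternative, inv_mul_cancel_left']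

/-- Left inner mappings respect cubes, so by injectivity of cubing they fix `k` once they fix its
cube. -/
theorem isNuclear_of_cube (hdiv : UniquelyDivisible 6 Q) {k : Q} (h : IsNuclear (cube k)) :
    IsNuclear k :=
  isNuclear_iff_leftInner.2 fun x y => cube_injective hdiv (by
    rw [← (pseudoAut_leftInner x y).map_cube, isNuclear_iff_leftInner.1 h])

/-- Conjugation by x³ is T_x applied three times. -/
theorem cube_mul_middleInner (x z : Q) :
    cube x * middleInner x (middleInner x (middleInner x z)) = z * cube x := by
  rw [cube_mul, mul_middleInner, ← flexible x (middleInner x _), mul_middleInner,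
    ← flexible, ← flexible, mul_middleInner, mul_cube]

end Moufang
section AbelianInn

variable {Q : Type*} [MulOneClass Q] [IsLoop Q] [IsMoufang Q]

attribute [local instance] loopInv

/-! ### Commutators -/

/-- The commutator of `x` and `z`, defined by `x * (commutator x z) = z \ (x * z)`. -/
noncomputable def loopCommutator (x z : Q) : Q := x⁻¹ * middleInner z x

theorem mul_loopCommutator (x z : Q) : x * loopCommutator x z = middleInner z x :=
  mul_inv_cancel_left' _ _

/-- `z` is central: nuclear and commuting with everything. -/
def IsCentral (z : Q) : Prop := IsNuclear z ∧ ∀ x, x * z = z * x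

theorem mul_mul_loopCommutator (x z : Q) : z * (x * loopCommutator x z) = x * z := by
  rw [mul_loopCommutator, mul_middleInner]

namespace IsNuclear

variable {n : Q}

theorem mul_mul_right (hn : IsNuclear n) (x y : Q) : (x * y) * n = x * (y * n) :=
  (hn y).mul_mul_right x

theorem mul_mul_mid (hn : IsNuclear n) (x y : Q) : (x * n) * y = x * (n * y) :=
  (hn x).mul_mul_left y

theorem mul_mul_left (hn : IsNuclear n) (x y : Q) : (n * x) * y = n * (x * y) :=
  (hn x).symm.mul_mul_left y

end IsNuclear

theorem commute_inv_of_commute {x u : Q} (h : x * u = u * x) : x * u⁻¹ = u⁻¹ * x := by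
  apply mul_right_cancel' (x := u)
  rw [inv_mul_cancel_right', (AssocPair.self u).inv_left, h, inv_mul_cancel_left']

theorem commute_cube {x u : Q} (h : x * u = u * x) :
    x * cube u = cube u * x := by
  rw [mul_cube, cube_mul, h, flexible u x, h, flexible u, flexible u x, h]

variable (hcomm : ∀ φ ∈ Inn Q, ∀ ψ ∈ Inn Q, ∀ z, φ (ψ z) = ψ (φ z))
include hcomm

theorem assocPair_inn (x : Q) {φ : Equiv.Perm Q} (hφ : φ ∈ Inn Q) : AssocPair x (φ x) :=
  AssocPair.of_mul_mul_right fun y => by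
    rw [← mul_leftInner, hcomm _ (leftInner_mem x y) _ hφ, leftInner_self]

theorem assocPair_loopCommutator (x z : Q) : AssocPair x (loopCommutator x z) :=
  (assocPair_inn hcomm x (middleInner_mem z)).inv_mul

omit hcomm in
theorem middleInner_self (x : Q) : middleInner x x = x :=
  mul_left_cancel' (x := x) (mul_middleInner x x)

theorem commute_loopCommutator (x z : Q) :
    x * loopCommutator x z = loopCommutator x z * x := by
  have h : x * middleInner z x = middleInner z x * x := by
    rw [← mul_middleInner x (middleInner z x), hcomm _ (middleInner_mem x) _ (middleInner_mem z),
      middleInner_self]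
  rw [mul_loopCommutator, loopCommutator, (AssocPair.self x).inv_left, ← h, inv_mul_cancel_left']

theorem loopCommutator_swap (x z : Q) : loopCommutator z x = (loopCommutator x z)⁻¹ := by
  apply mul_left_cancel' (x := x * z)
  rw [(assocPair_loopCommutator hcomm z x).mul_mul_right, mul_mul_loopCommutator,
    ← mul_mul_loopCommutator x z, ← (assocPair_loopCommutator hcomm x z).mul_mul_right,
    mul_inv_cancel_right']

theorem assocPair_loopCommutator_right (x z : Q) : AssocPair z (loopCommutator x z) := by
  rw [loopCommutator_swap hcomm z x]
  exact (assocPair_loopCommutator hcomm z x).inv_right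

theorem commute_loopCommutator_right (x z : Q) :
    z * loopCommutator x z = loopCommutator x z * z := by
  rw [loopCommutator_swap hcomm z x]
  exact commute_inv_of_commute (commute_loopCommutator hcomm z x)

/-- The commutator k commutes and associates with x, so T_x carries a factor k along unchanged and
each application adds one more. -/
theorem middleInner_iterate (x y : Q) :
    middleInner x (middleInner x (middleInner x y)) = y * cube (loopCommutator y x) := by
  set k := loopCommutator y x with hk
  have hy : AssocPair y k := assocPair_loopCommutator hcomm y x
  have hx : AssocPair x k := assocPair_loopCommutator_right hcomm y x
  have hxk : x * k = k * x := commute_loopCommutator_right hcomm y x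
  have key : ∀ u, AssocPair u k → middleInner x (u * k) = middleInner x u * k := fun u hu => by
    apply mul_left_cancel' (x := x)
    rw [mul_middleInner, hu.mul_mul_left, ← hxk, ← hx.mul_mul_right, ← hx, mul_middleInner]
  have h2 : AssocPair (y * k) k := (hy.symm.mul_right (AssocPair.self k) hy).symm
  have h3 : middleInner x y = y * k := (mul_loopCommutator y x).symm
  rw [mul_cube, h3, key y hy, h3, key _ h2, key y hy, h3]

theorem IsNuclear.inn {n : Q} (hn : IsNuclear n) {φ : Equiv.Perm Q} (hφ : φ ∈ Inn Q) :
    IsNuclear (φ n) :=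
  isNuclear_iff_leftInner.2 fun x y => by
    rw [hcomm _ (leftInner_mem x y) _ hφ, isNuclear_iff_leftInner.1 hn]

theorem isNuclear_cube_loopCommutator (y x : Q) : IsNuclear (cube (loopCommutator y x)) := by
  set k := loopCommutator y x with hk
  have hy : AssocPair y k := assocPair_loopCommutator hcomm y x
  have hx : AssocPair x k := assocPair_loopCommutator_right hcomm y x
  have hyk : y * k = k * y := commute_loopCommutator hcomm y x
  have hxk : x * k⁻¹ = k⁻¹ * x :=
    commute_inv_of_commute (commute_loopCommutator_right hcomm y x)
  have h1 : middleInner x (cube y) = cube y * cube k := by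
    rw [(pseudoAut_middleInner x).map_cube, ← mul_loopCommutator, cube_mul_of_commute hy hyk]
  have h2 : middleInner y (cube x) = cube x * (cube k)⁻¹ := by
    rw [(pseudoAut_middleInner y).map_cube, ← mul_loopCommutator, loopCommutator_swap hcomm y x,
      cube_mul_of_commute hx.inv_right hxk, inv_cube]
  have h3 : cube y * cube x = cube x * (cube y * cube (cube k)) := by
    rw [← cube_mul_middleInner, (pseudoAut_middleInner x).map_cube,
      (pseudoAut_middleInner x).map_cube, (pseudoAut_middleInner x).map_cube,
      middleInner_iterate hcomm, cube_mul_of_commute hy.cube_right (commute_cube hyk)]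
  set q := cube k
  have hY : AssocPair (cube y) q := hy.cube
  have hX : AssocPair (cube x) q := hx.cube
  have hxy := (pseudoAut_middleInner x).comp (pseudoAut_middleInner y)
  have hyx := (pseudoAut_middleInner y).comp (pseudoAut_middleInner x)
  simp only [hcomm _ (middleInner_mem y) _ (middleInner_mem x)] at hyx
  obtain ⟨n, hn, e⟩ := PseudoAut.exists_nuclear
    ((middleInner x).surjective.comp (middleInner y).surjective) hxy hyx
  rw [h1, h2, ← hX.inv_right.mul_mul_right, h3, ← hY.cube_right.mul_mul_right, mul_cube q,
    mul_inv_cancel_right', ← hY.mul_mul_right] at e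
  -- By `h3` the two companions are x³y³·q and x³y³·q². So `e` reads h = n * (h * q), and q is a
  -- conjugate of n⁻¹.
  set h := cube x * cube y * q
  have hq : q = middleInner h n⁻¹ := by
    rw [middleInner_eq]
    apply mul_left_cancel' (x := h)
    rw [mul_inv_cancel_left']
    apply mul_left_cancel' (x := n)
    rw [← e, mul_inv_cancel_left']
  rw [hq]
  exact hn.inv.inn hcomm (middleInner_mem h)

variable (hdiv : UniquelyDivisible 6 Q)
include hdiv

theorem isNuclear_loopCommutator (x z : Q) : IsNuclear (loopCommutator x z) :=
  isNuclear_of_cube hdiv (isNuclear_cube_loopCommutator hcomm x z)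

/-- The companion (vu)(uv)⁻¹ is a conjugate of [v, u], hence nuclear. -/
theorem leftInner_mul (u v x y : Q) :
    leftInner u v (x * y) = leftInner u v x * leftInner u v y := by
  apply (pseudoAut_leftInner u v).map_mul
  have hk := isNuclear_loopCommutator hcomm hdiv v u
  have h : v * u = (u * v) * loopCommutator v u := by
    rw [hk.mul_mul_right, mul_mul_loopCommutator]
  have := hk.inn hcomm (middleInner_mem (u * v)⁻¹)
  rwa [middleInner_eq, inv_inv', ← hk.mul_mul_mid, ← h, mul_inv_rev'] at this

/-! ### Centrality of associators and commutators -/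

/-- Take c = z³. Since T_z moves every element by a nuclear factor, its identity with companion c
becomes the claim modulo the nucleus. -/
theorem exists_nuclear_mul_mul (c x y : Q) :
    ∃ n, IsNuclear n ∧ (x * c⁻¹) * (c * y) = (x * y) * n := by
  obtain ⟨z, rfl⟩ := cube_surjective hdiv c
  have h := pseudoAut_middleInner z x y
  have hk := fun x => isNuclear_loopCommutator hcomm hdiv x z
  set c := cube z
  have hn := (hk x).inn hcomm (middleInner_mem c⁻¹)
  have hm := hn.inn hcomm (middleInner_mem (c * y))
  simp only [← mul_loopCommutator] at h
  rw [(hk x).mul_mul_mid, ← mul_middleInner c⁻¹, ← hn.mul_mul_right, ← (hk y).mul_mul_right,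
    ← (hk y).mul_mul_right, hn.mul_mul_mid, ← mul_middleInner (c * y), ← hm.mul_mul_right] at h
  refine ⟨_, ((hk (x * y)).mul (hk y).inv).mul hm.inv, ?_⟩
  rw [← hm.inv.mul_mul_right, ← (hk y).inv.mul_mul_right, ← h, mul_inv_cancel_right',
    mul_inv_cancel_right']

theorem exists_nuclear_leftInner (u v z : Q) : ∃ n, IsNuclear n ∧ leftInner u v z = z * n := by
  obtain ⟨n, hn, e⟩ := exists_nuclear_mul_mul hcomm hdiv u (v * u) z
  refine ⟨n, hn, mul_left_cancel' (x := v * u) ?_⟩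
  rw [mul_leftInner, ← hn.mul_mul_right, ← e, mul_inv_cancel_right']

theorem exists_central_leftInner (u v z : Q) : ∃ n, IsCentral n ∧ leftInner u v z = z * n := by
  obtain ⟨n, hn, e⟩ := exists_nuclear_leftInner hcomm hdiv u v z
  refine ⟨n, ⟨hn, fun x => ?_⟩, e⟩
  obtain ⟨w', hw'⟩ := (middleInner z).surjective x
  obtain ⟨w, rfl⟩ := (leftInner u v).surjective w'
  -- Apply the automorphism `leftInner u v` to z * T_z w = w * z. Both sides acquire n, which must
  -- then commute with the arbitrary element x.
  have h1 : leftInner u v z * middleInner z (leftInner u v w)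
      = leftInner u v w * leftInner u v z := by
    rw [← leftInner_mul hcomm hdiv, ← mul_middleInner z w, leftInner_mul hcomm hdiv,
      hcomm _ (leftInner_mem u v) _ (middleInner_mem z)]
  rw [e, ← hn.mul_mul_right, ← mul_middleInner z, hw', hn.mul_mul_mid, hn.mul_mul_right] at h1
  exact (mul_left_cancel' h1).symm

omit hdiv in
theorem middleInner_mul_nuclear {n : Q} (hn : IsNuclear n) (a b : Q) :
    middleInner (a * b) n = middleInner b (middleInner a n) := by
  have ha := hn.inn hcomm (middleInner_mem a)
  apply mul_left_cancel' (x := a * b)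
  rw [mul_middleInner, ← hn.mul_mul_left, ← mul_middleInner a, ha.mul_mul_mid,
    ← mul_middleInner b, (ha.inn hcomm (middleInner_mem b)).mul_mul_right]

/-- On the nucleus T_{ab} = T_b T_a, so T_{xz} and T_{zx} agree there. As xz = (zx)k, T_k is trivial
on the nucleus. -/
theorem commute_loopCommutator_nuclear (x z : Q) {n : Q} (hn : IsNuclear n) :
    n * loopCommutator x z = loopCommutator x z * n := by
  set k := loopCommutator x z with hk
  have hkn : IsNuclear k := isNuclear_loopCommutator hcomm hdiv x z
  have ha : x * z = (z * x) * k := by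
    rw [hkn.mul_mul_right, mul_mul_loopCommutator]
  have h0 : IsNuclear ((middleInner (z * x))⁻¹ n) := hn.inn hcomm (inv_mem (middleInner_mem _))
  have h : middleInner k n = n := by
    have h1 := middleInner_mul_nuclear hcomm h0 (z * x) k
    rw [← ha, middleInner_mul_nuclear hcomm h0, hcomm _ (middleInner_mem z) _ (middleInner_mem x),
      ← middleInner_mul_nuclear hcomm h0, Equiv.Perm.inv_def,
      Equiv.apply_symm_apply] at h1
    exact h1.symm
  rw [← mul_middleInner, h]

omit hdiv in
theorem middleInner_mul_of_nuclear (w x : Q) {n : Q} (hn : IsNuclear n) :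
    middleInner w (x * n) = middleInner w x * middleInner w n := by
  have h := hn.inn hcomm (middleInner_mem w)
  rw [← pseudoAut_middleInner w, ← h.mul_mul_right, inv_mul_cancel_right']

omit hdiv in
theorem loopCommutator_inv {n : Q} (hn : IsNuclear n) (w : Q)
    (h : middleInner w n * n = n * middleInner w n) :
    loopCommutator n⁻¹ w = (loopCommutator n w)⁻¹ := by
  have h1 : middleInner w n⁻¹ = (middleInner w n)⁻¹ := by
    apply eq_inv_of_mul_eq_one
    rw [← middleInner_mul_of_nuclear hcomm w n hn.inv, mul_inv_self',
      (pseudoAut_middleInner w).map_one]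
  rw [loopCommutator, loopCommutator, h1, ← mul_inv_rev', commute_inv_of_commute h]

/-- Expand T_w T_z x = T_z T_w x and cancel. -/
theorem loopCommutator_loopCommutator_comm (x z w : Q) :
    loopCommutator (loopCommutator x z) w = loopCommutator (loopCommutator x w) z := by
  have hN := isNuclear_loopCommutator hcomm hdiv
  have h := hcomm _ (middleInner_mem w) _ (middleInner_mem z) x
  rw [← mul_loopCommutator x z, ← mul_loopCommutator x w,
    middleInner_mul_of_nuclear hcomm _ _ (hN x z), middleInner_mul_of_nuclear hcomm _ _ (hN x w), ← mul_loopCommutator x z,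
    ← mul_loopCommutator x w, ← mul_loopCommutator _ w, ← mul_loopCommutator _ z,
    (hN x z).mul_mul_mid, (hN x w).mul_mul_mid, ← (hN x z).mul_mul_left,
    ← (hN x w).mul_mul_left, commute_loopCommutator_nuclear hcomm hdiv x z (hN x w)] at h
  exact mul_left_cancel' (mul_left_cancel' h)

theorem isCentral_loopCommutator (x z : Q) : IsCentral (loopCommutator x z) := by
  have hN := isNuclear_loopCommutator hcomm hdiv
  refine ⟨hN x z, fun w => ?_⟩
  have hs : ∀ x z w : Q, loopCommutator (loopCommutator z x) w
      = (loopCommutator (loopCommutator x z) w)⁻¹ := fun x z w => by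
    rw [loopCommutator_swap hcomm x z]
    exact loopCommutator_inv hcomm (hN x z) w
      (commute_loopCommutator_nuclear hcomm hdiv x z ((hN x z).inn hcomm (middleInner_mem w)))
  have hc := loopCommutator_loopCommutator_comm hcomm hdiv
  have h1 : loopCommutator (loopCommutator x z) w
      = (loopCommutator (loopCommutator x z) w)⁻¹ := by
    -- Alternating the two swaps three times returns to the start after three inversions.
    conv_lhs => rw [hc, hs, hc, hs, inv_inv', hc, hs]
  have h2 : loopCommutator (loopCommutator x z) w = 1 := by
    apply eq_one_of_mul_self hdiv
    nth_rw 1 [h1]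
    exact inv_mul_self' _
  rw [← mul_mul_loopCommutator _ w, h2, mul_one]

/-! ### Associativity -/

/-- The associator defect `y \ (x \ ((x / c) * (c * y)))`. -/
noncomputable def defect (c x y : Q) : Q := y⁻¹ * leftInner c (x * c⁻¹) y

omit hcomm hdiv in
theorem leftInner_eq_mul_defect (c x y : Q) :
    leftInner c (x * c⁻¹) y = y * defect c x y := (mul_inv_cancel_left' _ _).symm

theorem isCentral_defect (c x y : Q) : IsCentral (defect c x y) := by
  obtain ⟨n, hn, e⟩ := exists_central_leftInner hcomm hdiv c (x * c⁻¹) y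
  rwa [defect, e, inv_mul_cancel_left']

theorem mul_mul_defect (c x y : Q) : (x * y) * defect c x y = (x * c⁻¹) * (c * y) := by
  rw [(isCentral_defect hcomm hdiv c x y).1.mul_mul_right, ← leftInner_eq_mul_defect]
  simpa only [inv_mul_cancel_right'] using mul_leftInner c (x * c⁻¹) y

theorem defect_self (c x : Q) : defect c x x = 1 := by
  apply mul_left_cancel' (x := x * x)
  rw [mul_mul_defect hcomm hdiv, middle_moufang, inv_mul_self', one_mul, mul_one]

theorem defect_mul_right (c x y z : Q) :
    defect c x (y * z) = defect c x y * defect c x z := by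
  have hy := isCentral_defect hcomm hdiv c x y
  have hz := isCentral_defect hcomm hdiv c x z
  apply mul_left_cancel' (x := y * z)
  rw [← leftInner_eq_mul_defect, leftInner_mul hcomm hdiv, leftInner_eq_mul_defect,
    leftInner_eq_mul_defect, ← hz.1.mul_mul_right, hy.1.mul_mul_mid, ← hy.2 z,
    ← hy.1.mul_mul_right, hz.1.mul_mul_right]

/-- For c = z³ the defect measures how [xy, z] differs from [x, z][y, z]. Since xy and yx differ by
a central factor, [xy, z] = [yx, z]. -/
theorem defect_symm (c x y : Q) : defect c x y = defect c y x := by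
  obtain ⟨z, rfl⟩ := cube_surjective hdiv c
  have hk := fun x => isCentral_loopCommutator hcomm hdiv x z
  have hB := isCentral_defect hcomm hdiv (cube z)
  have key : ∀ x y, defect (cube z) x y * (loopCommutator x z * loopCommutator y z)
      = loopCommutator (x * y) z := fun x y => by
    have h := pseudoAut_middleInner z x y
    simp only [← mul_loopCommutator] at h
    rw [(hk x).1.mul_mul_mid, ← (hk x).2, ← (hk x).1.mul_mul_right, (hk x).1.mul_mul_mid,
      ← (hk x).2, ← (hk y).1.mul_mul_right, (hk y).1.mul_mul_mid, ← (hk y).2,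
      ← ((hk x).1.mul (hk y).1).mul_mul_right, ← mul_mul_defect hcomm hdiv,
      ((hk x).1.mul (hk y).1).mul_mul_right] at h
    exact mul_left_cancel' h
  have hyx : loopCommutator (y * x) z = loopCommutator (x * y) z := by
    have hj := isCentral_loopCommutator hcomm hdiv y x
    have h : y * x = (x * y) * loopCommutator y x := by
      rw [hj.1.mul_mul_right, mul_mul_loopCommutator]
    apply mul_left_cancel' (x := y * x)
    have hz : middleInner z (loopCommutator y x) = loopCommutator y x :=
      mul_left_cancel' (x := z) (by rw [mul_middleInner, hj.2])
    rw [mul_loopCommutator, h, middleInner_mul_of_nuclear hcomm _ _ hj.1, hz,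
      ← mul_loopCommutator (x * y), hj.1.mul_mul_mid, ← hj.2, hj.1.mul_mul_right]
  have h1 := key x y
  rw [← hyx, ← key y x, (hk y).2 (loopCommutator x z)] at h1
  exact mul_right_cancel' h1

theorem defect_eq_one (c x y : Q) : defect c x y = 1 := by
  apply eq_one_of_mul_self hdiv
  -- Polarization: the expansion loses its diagonal terms and leaves the square of `defect c x y`.
  have h := defect_self hcomm hdiv c (x * y)
  rwa [defect_mul_right hcomm hdiv, defect_symm hcomm hdiv c _ x, defect_symm hcomm hdiv c _ y,
    defect_mul_right hcomm hdiv, defect_mul_right hcomm hdiv, defect_self hcomm hdiv,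
    defect_self hcomm hdiv, one_mul, mul_one, defect_symm hcomm hdiv c y x] at h

theorem mul_assoc_of_abelian_inn (x y z : Q) : (x * y) * z = x * (y * z) := by
  -- Chosen so that the left factor (xy)y⁻¹ collapses to x.
  have h := mul_mul_defect hcomm hdiv y (x * y) z
  rwa [defect_eq_one hcomm hdiv, mul_one, mul_inv_cancel_right'] at h

omit hdiv hcomm

theorem IsCentral.mem_center {z : Q} (hz : IsCentral z) : z ∈ (center Q).carrier :=
  (fixed_iff z).2 ⟨fun x => (hz.2 x).symm, fun x y => (hz.1.mul_mul_right y x).symm,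
    fun x y => hz.1.mul_mul_left x y⟩

end AbelianInn

/-! ### Iterated centers and nilpotency class -/

section Nilpotent

variable {Q : Type*} [MulOneClass Q] [IsLoop Q]

theorem proj_mem_center (N : NormalSubloop Q) {z : Q} (hz : z ∈ (center Q).carrier) :
    N.proj z ∈ (center N.Factor).carrier := by
  obtain ⟨h1, h2, h3⟩ := (fixed_iff z).1 hz
  refine (fixed_iff _).2 ⟨fun a => ?_, fun a b => ?_, fun a b => ?_⟩
  · obtain ⟨x, rfl⟩ := N.proj_surjective a
    exact congrArg N.proj (h1 x)
  · obtain ⟨x, rfl⟩ := N.proj_surjective a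
    obtain ⟨y, rfl⟩ := N.proj_surjective b
    exact congrArg N.proj (h2 x y)
  · obtain ⟨x, rfl⟩ := N.proj_surjective a
    obtain ⟨y, rfl⟩ := N.proj_surjective b
    exact congrArg N.proj (h3 x y)

theorem iteratedCenter_two_eq_univ (hassoc : ∀ x y z : Q, (x * y) * z = x * (y * z))
    (hc : ∀ x z : Q, ∃ k ∈ (center Q).carrier, x * z = (z * x) * k) :
    (iteratedCenter Q 2).carrier = Set.univ := by
  refine Set.eq_univ_of_forall fun x => ?_
  let N := iteratedCenter Q 1
  change N.proj x ∈ (center N.Factor).carrier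
  have ha : ∀ a b c : N.Factor, (a * b) * c = a * (b * c) := fun a b c => by
    obtain ⟨x, rfl⟩ := N.proj_surjective a
    obtain ⟨y, rfl⟩ := N.proj_surjective b
    obtain ⟨z, rfl⟩ := N.proj_surjective c
    exact congrArg N.proj (hassoc x y z)
  refine (fixed_iff _).2 ⟨fun a => ?_, fun a b => (ha _ _ _).symm, fun a b => ha _ _ _⟩
  obtain ⟨z, rfl⟩ := N.proj_surjective a
  obtain ⟨k, hk, e⟩ := hc z x
  -- Z₁ is by definition a preimage from Q/{1}, so centrality of k must be passed to that factor.
  exact N.proj_eq.2 ⟨k, proj_mem_center (trivial Q) hk, e⟩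

theorem exists_hasNilpotencyClass_le {n : ℕ} (h : (iteratedCenter Q n).carrier = Set.univ) :
    ∃ m ≤ n, HasNilpotencyClass Q m := by
  classical
  have hex : ∃ i, (iteratedCenter Q i).carrier = Set.univ := ⟨n, h⟩
  exact ⟨Nat.find hex, Nat.find_min' hex h, Nat.find_spec hex, fun i hi => Nat.find_min' hex hi⟩

end Nilpotent

end IsLoop

theorem mainTheorem2 (Q : Type*) [MulOneClass Q] [IsLoop Q] [IsMoufang Q]
    (hdiv : IsLoop.UniquelyDivisible 6 Q)
    (hInn : IsMulCommutative (IsLoop.Inn Q)) :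
    (∃ m : ℕ, m ≤ 2 ∧ IsLoop.HasNilpotencyClass Q m) ∧
      (∀ x y z : Q, (x * y) * z = x * (y * z)) := by
  have hcomm : ∀ φ ∈ IsLoop.Inn Q, ∀ ψ ∈ IsLoop.Inn Q, ∀ z, φ (ψ z) = ψ (φ z) :=
    fun φ hφ ψ hψ z => by
      have := congrArg Subtype.val (hInn.is_comm.comm (⟨φ, hφ⟩ : IsLoop.Inn Q) ⟨ψ, hψ⟩)
      exact DFunLike.congr_fun this z
  have hassoc := IsLoop.mul_assoc_of_abelian_inn hcomm hdiv
  refine ⟨IsLoop.exists_hasNilpotencyClass_le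
    (IsLoop.iteratedCenter_two_eq_univ hassoc fun x z => ?_), hassoc⟩
  exact ⟨_, (IsLoop.isCentral_loopCommutator hcomm hdiv x z).mem_center, by
    rw [hassoc, IsLoop.mul_mul_loopCommutator]⟩
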